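/- For a dyadic interval $J=[j2^{-k},(j+1)2^{-k})$ let $h_J=-\mathbf 1_{J_{\rm left}}+\mathbf 1_{J_{\rm right}}$, and for a dyadic rectangle $R=R_1\times R_2\times R_3\subset[0,1)^3$ let $h_R(x)=\prod_{k=1}^3 h_{R_k}(x_k)$. For $\vec r\in\{0,1,2,\dots\}^3$, an $\mathsf r$-function with parameter $\vec r$ is a function $\sum_R\varepsilon_R h_R$ with arbitrary signs $\varepsilon_R\in\{\pm1\}$, the sum being over all dyadic rectangles $R\subset[0,1)^3$ with $|R_k|=2^{-r_k}$, $k=1,2,3$. Let $\mathbb H_n$ be the set of $\vec r\in\{0,1,2,\dots\}^3$ with $r_1+r_2+r_3=n$. Norms and probabilities are with respect to Lebesgue measure on $[0,1]^3$. There are absolute constants $0<c<1$ and $K>0$ such that the following holds for all integers $n\ge1$ and $1\le q\le n^{1/3}$ (in particular for $q=\lfloor a n^{\varepsilon}\rfloor\ge1$ with $0<a\le1$, $0<\varepsilon\le 1/3$). Divide $\{1,\dots,n\}$ into $q$ disjoint intervals $I_1,\dots,I_q$ of integers, each of length $n/q$ up to rounding (that is, of cardinality $\lfloor n/q\rfloor$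 or $\lfloor n/q\rfloor+1$), for each $\vec r\in\mathbb H_n$ let $f_{\vec r}$ be an $\mathsf r$-function with parameter $\vec r$, and put $$F_t=\sum_{\vec r\in\mathbb H_n,\ r_1\in I_t} f_{\vec r},\qquad \rho=\frac{\sqrt q}{n}.$$ Then for every $1\le t\le q$, $$\|\rho F_t\|_p\le K\sqrt p\qquad\text{for all real } 1\le p\le c\,n^{1/3},$$ and $$\mathbb P(\rho F_t>x)\le K\exp(-c x^2)\qquad\text{for all } 0\le x<c\,n^{1/6}.$$ -/

import Mathlib

open MeasureTheory

noncomputable section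

namespace Hyperbolic

/-- The dyadic interval `[j 2^{-k}, (j+1) 2^{-k})`. -/
def dyadicInterval (k j : ℕ) : Set ℝ :=
  Set.Ico ((j : ℝ) / 2 ^ k) (((j : ℝ) + 1) / 2 ^ k)

/-- The `L^∞`-normalized Haar function `-1_{left half} + 1_{right half}` of `dyadicInterval k j`. -/
def haar (k j : ℕ) (x : ℝ) : ℝ :=
  -(dyadicInterval (k + 1) (2 * j)).indicator 1 x
    + (dyadicInterval (k + 1) (2 * j + 1)).indicator 1 x

/-- The dyadic rectangles `R ⊆ [0,1)^3` with side lengths `2^{-r 0}, 2^{-r 1}, 2^{-r 2}`,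
each given by the positions of its sides. -/
abbrev Rect (r : Fin 3 → ℕ) : Type := (i : Fin 3) → Fin (2 ^ r i)

/-- The Haar function of a rectangle: the tensor product of the Haar functions of its sides. -/
def haarRect (r : Fin 3 → ℕ) (R : Rect r) (x : Fin 3 → ℝ) : ℝ :=
  ∏ i, haar (r i) (R i) (x i)

/-- `f` is an `r`-function with parameter `r`: a sum `∑ ε_R h_R`, with signs `ε_R = ±1`, over all
dyadic rectangles `R ⊆ [0,1)^3` with side lengths `2^{-r i}`. -/
def IsRFunction (r : Fin 3 → ℕ) (f : (Fin 3 → ℝ) → ℝ) : Prop :=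
  ∃ ε : Rect r → ℝ, (∀ R, ε R = 1 ∨ ε R = -1) ∧ ∀ x, f x = ∑ R, ε R * haarRect r R x

/-- The hyperbolic vectors: triples of natural numbers with sum `n`. -/
def hyperbolicVectors (n : ℕ) : Finset (Fin 3 → ℕ) :=
  Finset.Nat.antidiagonalTuple 3 n

/-- `I` divides `{1, …, n}` into `q` disjoint intervals of length `n / q`, up to rounding. -/
structure IsIntervalPartition (n q : ℕ) (I : Fin q → Finset ℕ) : Prop where
  interval : ∀ t, ∃ a b, I t = Finset.Icc a b
  disjoint : ∀ s t, s ≠ t → Disjoint (I s) (I t)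
  cover : Finset.univ.biUnion I = Finset.Icc 1 n
  length : ∀ t, (I t).card = n / q ∨ (I t).card = n / q + 1

/-- The block sum: the sum of `f r` over the hyperbolic vectors `r` with first coordinate in `J`. -/
def blockSum (n : ℕ) (J : Finset ℕ) (f : (Fin 3 → ℕ) → (Fin 3 → ℝ) → ℝ) (x : Fin 3 → ℝ) : ℝ :=
  ∑ r ∈ (hyperbolicVectors n).filter (fun r => r 0 ∈ J), f r x

/-- The true `L^2` normalization `√q / n`. -/
def rho (n q : ℕ) : ℝ := Real.sqrt q / n

/-- Lebesgue measure on the unit cube `[0,1]^3`. -/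
def cubeMeasure : Measure (Fin 3 → ℝ) := volume.restrict (Set.Icc 0 1)

end Hyperbolic

end

/-!
In its first variable, the row sum `G s`, the sum of the `f r` over the vectors `r` with
`r 0 = s`, lies in the span of the Haar functions of level `s`. Hence `∑ s ∈ J, G s` is a
martingale, and `exp (∑ s ∈ J, (r * G s - r ^ 2 * G s ^ 2 / 2))` has integral at most `1`: the block
sum has Gaussian tails on the event `∑ s ∈ J, G s ^ 2 ≤ V`, and it remains to bound this square
function, off a small set, by a value `V` of the order of its mean.

For each choice of signs `ω s = ±1`, the sum `∑ s ∈ J, ω s * G s` is a martingale in the second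
variable, with square function `∑ s, ∑ t, ω s * ω t * C s t`, where the correlation `C s t` is the
sum of `f r * f r'` over the pairs with `r 0 = s`, `r' 0 = t` and `r 1 = r' 1`. Averaging its
exponential over `ω`, and bounding the average from below by Gibbs' variational principle with signs
biased towards those of the `G s`, gives the exponential integrability of `∑ s ∈ J, G s ^ 2` on the
set where all `G s`, and all `C s t` with `s ≠ t`, are at most `L`. There Azuma's inequality takes
over: `G s` is a sum of bounded martingale differences in the second variable, and so is `C s t` in
the third, because products of Haar functions of different levels are again Haar functions. With
`ν = n ^ (1 / 3)`, the choice `L = 3 * ν ^ 2 * w` makes all error terms at most a constant times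
`exp (-p * w)` for `p ≤ ν`.
-/

noncomputable section

namespace Hyperbolic

open Finset

/-! ### Haar functions on the line -/

/-- The sign `-1` on the left halves and `1` on the right halves of the dyadic intervals of length
`2 ^ (-k)` of the whole real line. -/
def rademacher (k : ℕ) (x : ℝ) : ℝ := if Even ⌊2 ^ (k + 1) * x⌋ then -1 else 1

/-- The linear combinations of the Haar functions of the dyadic intervals of length `2 ^ (-k)`,
that is, the products of `rademacher k` with functions that are constant on these intervals.
Members of `haarSpace 0, haarSpace 1, …` form a martingale difference sequence on `[0, 1)`. -/
def haarSpace (k : ℕ) : Submodule ℝ (ℝ → ℝ) :=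
  LinearMap.range
    (LinearMap.mulLeft ℝ (rademacher k) ∘ₗ LinearMap.funLeft ℝ ℝ fun x : ℝ => ⌊2 ^ k * x⌋)

lemma mem_haarSpace {k : ℕ} {g : ℝ → ℝ} :
    g ∈ haarSpace k ↔ ∃ c : ℤ → ℝ, ∀ x, g x = rademacher k x * c ⌊2 ^ k * x⌋ := by
  simp only [haarSpace, LinearMap.mem_range, funext_iff, eq_comm (b := g _)]
  rfl

lemma measurable_rademacher (k : ℕ) : Measurable (rademacher k) :=
  (measurable_from_top (f := fun m : ℤ => if Even m then (-1 : ℝ) else 1)).comp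
    (measurable_const_mul (2 ^ (k + 1) : ℝ)).floor

lemma measurable_of_mem_haarSpace {k : ℕ} {g : ℝ → ℝ} (hg : g ∈ haarSpace k) : Measurable g := by
  obtain ⟨c, hc⟩ := mem_haarSpace.1 hg
  rw [funext hc]
  exact (measurable_rademacher k).mul
    (measurable_from_top.comp (measurable_const_mul (2 ^ k : ℝ)).floor)

lemma rademacher_succ_add_div_two (k : ℕ) (d : ℤ) (x : ℝ) :
    rademacher (k + 1) ((x + d) / 2) = rademacher k x := by
  have h : (2 : ℝ) ^ (k + 2) * ((x + d) / 2) = 2 ^ (k + 1) * x + ((2 ^ (k + 1) * d : ℤ) : ℝ) := by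
    push_cast
    ring
  simp only [rademacher, h, Int.floor_add_intCast]
  simp [Int.even_add, parity_simps]

lemma comp_add_div_two_mem_haarSpace {k : ℕ} {g : ℝ → ℝ} (hg : g ∈ haarSpace (k + 1)) (d : ℤ) :
    (fun x => g ((x + d) / 2)) ∈ haarSpace k := by
  obtain ⟨c, hc⟩ := mem_haarSpace.1 hg
  refine mem_haarSpace.2 ⟨fun m => c (m + 2 ^ k * d), fun x => ?_⟩
  have h : (2 : ℝ) ^ (k + 1) * ((x + d) / 2) = 2 ^ k * x + ((2 ^ k * d : ℤ) : ℝ) := by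
    push_cast
    ring
  rw [hc, rademacher_succ_add_div_two, h, Int.floor_add_intCast]

lemma floor_two_pow_mul {b k : ℕ} (h : b ≤ k) (x : ℝ) :
    ⌊2 ^ b * x⌋ = ⌊2 ^ k * x⌋ / 2 ^ (k - b) := by
  have hx : 2 ^ b * x = 2 ^ k * x / ((2 ^ (k - b) : ℕ) : ℝ) := by
    rw [eq_div_iff (by positivity), ← Nat.add_sub_of_le h]
    push_cast
    rw [Nat.add_sub_cancel_left, pow_add]
    ring
  rw [hx, Int.floor_div_natCast]
  push_cast
  rfl

lemma mul_mem_haarSpace {b k : ℕ} (hbk : b < k) {g h : ℝ → ℝ} (hg : g ∈ haarSpace k)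
    (hh : h ∈ haarSpace b) : (fun x => g x * h x) ∈ haarSpace k := by
  obtain ⟨c, hc⟩ := mem_haarSpace.1 hg
  obtain ⟨d, hd⟩ := mem_haarSpace.1 hh
  refine mem_haarSpace.2 ⟨fun m => c m *
    ((if Even (m / 2 ^ (k - (b + 1))) then -1 else 1) * d (m / 2 ^ (k - b))), fun x => ?_⟩
  have hbk' : b + 1 ≤ k := hbk
  simp only [hc, hd, mul_assoc, rademacher, floor_two_pow_mul hbk.le, floor_two_pow_mul hbk']

lemma haar_eq (k j : ℕ) (x : ℝ) :
    haar k j x = rademacher k x * if ⌊2 ^ k * x⌋ = j then 1 else 0 := by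
  have mem_iff (k j : ℕ) : x ∈ dyadicInterval k j ↔ ⌊2 ^ k * x⌋ = j := by
    rw [dyadicInterval, Set.mem_Ico, Int.floor_eq_iff, div_le_iff₀ (by positivity),
      lt_div_iff₀ (by positivity), mul_comm x, Int.cast_natCast]
  have hdiv : ⌊2 ^ k * x⌋ = ⌊2 ^ (k + 1) * x⌋ / 2 := by
    simpa using floor_two_pow_mul k.le_succ x
  classical
  simp only [haar, rademacher, Set.indicator_apply, mem_iff, hdiv, Pi.one_apply]
  push_cast
  split_ifs <;> grind

lemma haar_mem_haarSpace (k j : ℕ) : haar k j ∈ haarSpace k :=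
  mem_haarSpace.2 ⟨fun m => if m = j then 1 else 0, haar_eq k j⟩

lemma sum_abs_haar_le_one (k : ℕ) (x : ℝ) : ∑ j : Fin (2 ^ k), |haar k j x| ≤ 1 := by
  have habs : |rademacher k x| = 1 := by
    unfold rademacher
    split_ifs <;> norm_num
  simp only [haar_eq, abs_mul, habs, one_mul, apply_ite abs, abs_one, abs_zero]
  rw [Finset.sum_boole]
  exact_mod_cast Finset.card_le_one.2 fun i hi j hj => Fin.ext <| by
    simpa using (mem_filter.1 hi).2.symm.trans (mem_filter.1 hj).2

/-! ### Exponential supermartingales -/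

/-- Lebesgue measure on `[0, 1)`. -/
abbrev unitMeasure : Measure ℝ := volume.restrict (Set.Ico 0 1)

instance : IsProbabilityMeasure unitMeasure := ⟨by simp⟩

lemma lintegral_unitMeasure_eq_half (φ : ℝ → ENNReal) :
    ∫⁻ x, φ x ∂unitMeasure =
      2⁻¹ * (∫⁻ x, φ ((x + (0 : ℤ)) / 2) ∂unitMeasure
        + ∫⁻ x, φ ((x + (1 : ℤ)) / 2) ∂unitMeasure) := by
  have half (d : ℤ) : ∫⁻ x in (fun y : ℝ => (y + d) / 2) '' Set.Ico 0 1, φ x =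
      2⁻¹ * ∫⁻ x, φ ((x + d) / 2) ∂unitMeasure := by
    rw [lintegral_image_eq_lintegral_abs_deriv_mul measurableSet_Ico
      (f := fun y => (y + d) / 2) (f' := fun _ => 1 / 2)
      (fun x _ => (((hasDerivAt_id x).add_const _).div_const 2).hasDerivWithinAt)
      (fun x _ y _ h => by simpa using h), lintegral_const_mul' _ _ ENNReal.ofReal_ne_top]
    congr 1
    rw [one_div, abs_of_pos (by norm_num), ENNReal.ofReal_inv_of_pos two_pos, ENNReal.ofReal_ofNat]
  have image (d : ℤ) : (fun y : ℝ => (y + d) / 2) '' Set.Ico 0 1 =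
      Set.Ico ((d : ℝ) / 2) ((d + 1) / 2) := by
    ext x
    simp only [Set.mem_image, Set.mem_Ico]
    exact ⟨by rintro ⟨y, hy, rfl⟩; constructor <;> linarith,
      fun hx => ⟨2 * x - d, by constructor <;> linarith, by ring⟩⟩
  rw [mul_add, ← half, ← half, image, image, ← lintegral_union measurableSet_Ico
    (Set.disjoint_left.2 fun x hx hx' => by
      have hlt := hx.2
      have hle := hx'.1
      norm_num at hlt hle
      linarith)]
  congr 2
  norm_num [Set.Ico_union_Ico_eq_Ico]

/-- The compensator `g ^ 2 / 2` makes the exponential of `g` a supermartingale increment. -/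
lemma half_exp_add_half_exp_neg_le_one (c : ℝ) :
    2⁻¹ * (Real.exp (-c - c ^ 2 / 2) + Real.exp (c - c ^ 2 / 2)) ≤ 1 := by
  have h := Real.cosh_le_exp_half_sq c
  rw [Real.cosh_eq] at h
  rw [Real.exp_sub, Real.exp_sub, ← add_div, ← mul_div_assoc, div_le_one (Real.exp_pos _)]
  linarith

lemma exists_eq_neg_and_eq_of_mem_haarSpace_zero {g : ℝ → ℝ} (hg : g ∈ haarSpace 0) :
    ∃ c, ∀ x ∈ Set.Ico (0 : ℝ) 1,
      g ((x + (0 : ℤ)) / 2) = -c ∧ g ((x + (1 : ℤ)) / 2) = c := by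
  obtain ⟨c, hc⟩ := mem_haarSpace.1 hg
  refine ⟨c 0, fun x hx => ?_⟩
  have h0 : ⌊x⌋ = 0 := Int.floor_eq_zero_iff.2 hx
  have h1 : ⌊x / 2⌋ = 0 := Int.floor_eq_zero_iff.2 ⟨by linarith [hx.1], by linarith [hx.2]⟩
  have h2 : ⌊(x + 1) / 2⌋ = 0 := Int.floor_eq_zero_iff.2 ⟨by linarith [hx.1], by linarith [hx.2]⟩
  simp [hc, rademacher, mul_div_cancel₀, h0, h1, h2]

lemma lintegral_exp_sum_sub_sq_le_one_of_range (N : ℕ) {g : ℕ → ℝ → ℝ}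
    (hg : ∀ k, g k ∈ haarSpace k) :
    ∫⁻ x, ENNReal.ofReal (Real.exp (∑ k ∈ range N, (g k x - g k x ^ 2 / 2))) ∂unitMeasure ≤ 1 := by
  induction N generalizing g with
  | zero => simp
  | succ N ih =>
    obtain ⟨c, hc⟩ := exists_eq_neg_and_eq_of_mem_haarSpace_zero (hg 0)
    have half (d : ℤ) (a : ℝ) (ha : ∀ x ∈ Set.Ico (0 : ℝ) 1, g 0 ((x + d) / 2) = a) :
        ∫⁻ x, ENNReal.ofReal (Real.exp (∑ k ∈ range (N + 1),
          (g k ((x + d) / 2) - g k ((x + d) / 2) ^ 2 / 2))) ∂unitMeasure ≤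
        ENNReal.ofReal (Real.exp (a - a ^ 2 / 2)) := by
      rw [setLIntegral_congr_fun (g := fun x => ENNReal.ofReal (Real.exp (a - a ^ 2 / 2)) *
        ENNReal.ofReal (Real.exp (∑ k ∈ range N,
          (g (k + 1) ((x + d) / 2) - g (k + 1) ((x + d) / 2) ^ 2 / 2)))) measurableSet_Ico
        fun x hx => by
          rw [sum_range_succ', ha x hx, add_comm, Real.exp_add, ENNReal.ofReal_mul (by positivity)],
        lintegral_const_mul' _ _ ENNReal.ofReal_ne_top]
      exact mul_le_of_le_one_right' (ih fun k => comp_add_div_two_mem_haarSpace (hg (k + 1)) d)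
    rw [lintegral_unitMeasure_eq_half]
    refine (mul_le_mul_right (add_le_add (half 0 _ fun x hx => (hc x hx).1)
      (half 1 _ fun x hx => (hc x hx).2)) _).trans ?_
    rw [← ENNReal.ofReal_add (by positivity) (by positivity), ← ENNReal.ofReal_ofNat 2,
      ← ENNReal.ofReal_inv_of_pos two_pos, ← ENNReal.ofReal_mul (by norm_num), neg_sq]
    exact ENNReal.ofReal_le_one.2 (half_exp_add_half_exp_neg_le_one c)

lemma measure_exp_le_le_exp_neg {α : Type*} [MeasurableSpace α] {P : Measure α} {Z : α → ℝ}
    (hZ : Measurable Z) (hP : ∫⁻ x, ENNReal.ofReal (Z x) ∂P ≤ 1) (u : ℝ) :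
    P {x | Real.exp u ≤ Z x} ≤ ENNReal.ofReal (Real.exp (-u)) := by
  have hu : ENNReal.ofReal (Real.exp u) ≠ 0 := (ENNReal.ofReal_pos.2 (Real.exp_pos u)).ne'
  calc P {x | Real.exp u ≤ Z x}
      ≤ P {x | ENNReal.ofReal (Real.exp u) ≤ ENNReal.ofReal (Z x)} :=
        measure_mono fun x hx => ENNReal.ofReal_le_ofReal hx
    _ ≤ (∫⁻ x, ENNReal.ofReal (Z x) ∂P) / ENNReal.ofReal (Real.exp u) :=
        meas_ge_le_lintegral_div hZ.ennreal_ofReal.aemeasurable hu ENNReal.ofReal_ne_top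
    _ ≤ 1 / ENNReal.ofReal (Real.exp u) := ENNReal.div_le_div_right hP _
    _ = ENNReal.ofReal (Real.exp (-u)) := by
        rw [one_div, Real.exp_neg, ENNReal.ofReal_inv_of_pos (Real.exp_pos u)]

section Martingale

variable {κ : Type*} {A : Finset κ} {ℓ : κ → ℕ} {g : κ → ℝ → ℝ} {y V : ℝ}

theorem lintegral_exp_sum_sub_sq_le_one (hℓ : Set.InjOn ℓ A) (hg : ∀ a ∈ A, g a ∈ haarSpace (ℓ a)) :
    ∫⁻ x, ENNReal.ofReal (Real.exp (∑ a ∈ A, (g a x - g a x ^ 2 / 2))) ∂unitMeasure ≤ 1 := by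
  classical
  let G (k : ℕ) : ℝ → ℝ := ∑ a ∈ A with ℓ a = k, g a
  have hG (k : ℕ) : G k ∈ haarSpace k := Submodule.sum_mem _ fun a ha => by
    obtain ⟨haA, rfl⟩ := mem_filter.1 ha
    exact hg a haA
  have hGℓ (a : κ) (ha : a ∈ A) : G (ℓ a) = g a := by
    have : {b ∈ A | ℓ b = ℓ a} = {a} := by
      ext b
      simp only [mem_filter, mem_singleton]
      exact ⟨fun h => hℓ h.1 ha h.2, by rintro rfl; exact ⟨ha, rfl⟩⟩
    simp only [G, this, sum_singleton]
  have hG0 (k : ℕ) (hk : k ∉ A.image ℓ) : G k = 0 :=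
    sum_eq_zero fun a ha => (hk (mem_image.2 ⟨a, mem_filter.1 ha⟩)).elim
  have hsum (x : ℝ) : ∑ a ∈ A, (g a x - g a x ^ 2 / 2) =
      ∑ k ∈ range ((A.image ℓ).sup id + 1), (G k x - G k x ^ 2 / 2) := by
    rw [← sum_subset (s₁ := A.image ℓ) (fun k hk => mem_range_succ_iff.2 (le_sup (f := id) hk))
      fun k _ hk => by simp [hG0 k hk], sum_image hℓ]
    exact sum_congr rfl fun a ha => by rw [hGℓ a ha]
  simp only [hsum]
  exact lintegral_exp_sum_sub_sq_le_one_of_range _ hG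

lemma unitMeasure_sum_sq_le_and_lt_sum_le (hℓ : Set.InjOn ℓ A)
    (hg : ∀ a ∈ A, g a ∈ haarSpace (ℓ a)) (hy : 0 ≤ y) (hV : 0 < V) :
    unitMeasure {x | ∑ a ∈ A, g a x ^ 2 ≤ V ∧ y < ∑ a ∈ A, g a x} ≤
      ENNReal.ofReal (Real.exp (-(y ^ 2 / (2 * V)))) := by
  set r := y / V
  have : 0 ≤ r := by positivity
  have hsum (x : ℝ) : ∑ a ∈ A, (r * g a x - (r * g a x) ^ 2 / 2) =
      r * ∑ a ∈ A, g a x - r ^ 2 / 2 * ∑ a ∈ A, g a x ^ 2 := by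
    rw [mul_sum, mul_sum, ← sum_sub_distrib]
    exact sum_congr rfl fun a _ => by ring
  have hmeas : Measurable fun x =>
      Real.exp (r * ∑ a ∈ A, g a x - r ^ 2 / 2 * ∑ a ∈ A, g a x ^ 2) := by
    have hga : ∀ a ∈ A, Measurable (g a) := fun a ha => measurable_of_mem_haarSpace (hg a ha)
    exact (((Finset.measurable_fun_sum A hga).const_mul r).sub
      ((Finset.measurable_fun_sum A fun a ha => (hga a ha).pow_const 2).const_mul _)).exp
  have hint : ∫⁻ x, ENNReal.ofReal
      (Real.exp (r * ∑ a ∈ A, g a x - r ^ 2 / 2 * ∑ a ∈ A, g a x ^ 2)) ∂unitMeasure ≤ 1 := by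
    simpa only [Pi.smul_apply, smul_eq_mul, hsum] using
      lintegral_exp_sum_sub_sq_le_one hℓ fun a ha => Submodule.smul_mem _ r (hg a ha)
  refine (measure_mono fun x hx => ?_).trans
    (measure_exp_le_le_exp_neg hmeas hint (y ^ 2 / (2 * V)))
  refine Real.exp_le_exp.2 ?_
  calc y ^ 2 / (2 * V) = r * y - r ^ 2 / 2 * V := by
        simp only [r]
        field_simp
        ring
    _ ≤ r * ∑ a ∈ A, g a x - r ^ 2 / 2 * ∑ a ∈ A, g a x ^ 2 := by
        gcongr
        exacts [hx.2.le, hx.1]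

theorem unitMeasure_sum_sq_le_and_lt_abs_sum_le (hℓ : Set.InjOn ℓ A)
    (hg : ∀ a ∈ A, g a ∈ haarSpace (ℓ a)) (hy : 0 ≤ y) (hV : 0 < V) :
    unitMeasure {x | ∑ a ∈ A, g a x ^ 2 ≤ V ∧ y < |∑ a ∈ A, g a x|} ≤
      ENNReal.ofReal (2 * Real.exp (-(y ^ 2 / (2 * V)))) := by
  have hneg := unitMeasure_sum_sq_le_and_lt_sum_le hℓ
    (fun a ha => Submodule.neg_mem _ (hg a ha)) hy hV
  simp only [Pi.neg_apply, neg_sq, sum_neg_distrib] at hneg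
  rw [two_mul, ENNReal.ofReal_add (by positivity) (by positivity)]
  refine (measure_mono fun x hx => ?_).trans ((measure_union_le _ _).trans
    (add_le_add (unitMeasure_sum_sq_le_and_lt_sum_le hℓ hg hy hV) hneg))
  exact (lt_abs.1 hx.2).imp (And.intro hx.1) (And.intro hx.1)

lemma unitMeasure_lt_abs_sum_le (hℓ : Set.InjOn ℓ A) (hg : ∀ a ∈ A, g a ∈ haarSpace (ℓ a))
    (hg1 : ∀ a ∈ A, ∀ x, |g a x| ≤ 1) (hA : #A ≤ V) (hy : 0 ≤ y) (hV : 0 < V) :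
    unitMeasure {x | y < |∑ a ∈ A, g a x|} ≤
      ENNReal.ofReal (2 * Real.exp (-(y ^ 2 / (2 * V)))) := by
  have hsq (x : ℝ) : ∑ a ∈ A, g a x ^ 2 ≤ V := calc
    ∑ a ∈ A, g a x ^ 2 ≤ ∑ _a ∈ A, (1 : ℝ) :=
        sum_le_sum fun a ha => (sq_le_one_iff_abs_le_one _).2 (hg1 a ha x)
    _ ≤ V := by simpa using hA
  simpa only [hsq, true_and] using unitMeasure_sum_sq_le_and_lt_abs_sum_le hℓ hg hy hV

end Martingale

/-! ### Random signs -/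

section Signs

variable {ι : Type*} [Fintype ι]

/-- The weight of the sign vector `ω` when its coordinates are independent with means `h i`. -/
def signWeight (h : ι → ℝ) (ω : ι → ℤˣ) : ℝ := ∏ i, (1 + h i * (ω i : ℤ)) / 2

lemma signWeight_nonneg {h : ι → ℝ} (hh : ∀ i, |h i| ≤ 1) (ω : ι → ℤˣ) : 0 ≤ signWeight h ω :=
  prod_nonneg fun i _ => by
    obtain ⟨h₁, h₂⟩ := abs_le.1 (hh i)
    rcases Int.units_eq_one_or (ω i) with hi | hi <;> simp [hi] <;> linarith

lemma signWeight_le {h : ι → ℝ} (hh : ∀ i, |h i| ≤ 1) (ω : ι → ℤˣ) :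
    signWeight h ω ≤ Real.exp (∑ i, h i * (ω i : ℤ)) / 2 ^ Fintype.card ι := by
  rw [Real.exp_sum, signWeight, prod_div_distrib, prod_const, card_univ]
  refine div_le_div_of_nonneg_right (prod_le_prod (fun i _ => ?_) fun i _ => ?_) (by positivity)
  · obtain ⟨h₁, h₂⟩ := abs_le.1 (hh i)
    rcases Int.units_eq_one_or (ω i) with hi | hi <;> simp [hi] <;> linarith
  · rw [add_comm]
    exact Real.add_one_le_exp _

variable [DecidableEq ι]

lemma sum_signWeight_mul_prod (h : ι → ℝ) (T : Finset ι) :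
    ∑ ω, signWeight h ω * ∏ i ∈ T, ((ω i : ℤ) : ℝ) = ∏ i ∈ T, h i := by
  have key := prod_univ_sum (fun _ : ι => (univ : Finset ℤˣ))
    fun i e => (1 + h i * (e : ℤ)) / 2 * if i ∈ T then ((e : ℤ) : ℝ) else 1
  rw [Fintype.piFinset_univ] at key
  calc ∑ ω, signWeight h ω * ∏ i ∈ T, ((ω i : ℤ) : ℝ)
      = ∑ ω : ι → ℤˣ, ∏ i, (1 + h i * (ω i : ℤ)) / 2 * if i ∈ T then ((ω i : ℤ) : ℝ) else 1 := by
        simp only [prod_mul_distrib, prod_ite_mem, univ_inter, signWeight]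
    _ = ∏ i, if i ∈ T then h i else 1 := by
        rw [← key]
        refine prod_congr rfl fun i _ => ?_
        rw [UnitsInt.univ, sum_pair (by decide)]
        split_ifs <;> push_cast <;> ring
    _ = ∏ i ∈ T, h i := by rw [prod_ite_mem, univ_inter]

lemma sum_signWeight (h : ι → ℝ) : ∑ ω, signWeight h ω = 1 := by
  simpa using sum_signWeight_mul_prod h ∅

lemma sum_signWeight_mul_linear (h a : ι → ℝ) :
    ∑ ω, signWeight h ω * ∑ i, a i * (ω i : ℤ) = ∑ i, a i * h i := by
  simp only [mul_sum]
  rw [sum_comm]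
  refine sum_congr rfl fun i _ => ?_
  have := sum_signWeight_mul_prod h {i}
  simp only [prod_singleton] at this
  simp only [← this, mul_sum, mul_left_comm]

lemma sum_signWeight_mul_quadratic (h : ι → ℝ) (C : ι → ι → ℝ) :
    ∑ ω, signWeight h ω * ∑ i, ∑ j, (ω i : ℤ) * (ω j : ℤ) * C i j =
      ∑ i, ∑ j, (if i = j then 1 else h i * h j) * C i j := by
  have moment (i j : ι) : ∑ ω, signWeight h ω * ((ω i : ℤ) * (ω j : ℤ)) =
      if i = j then 1 else h i * h j := by
    split_ifs with hij
    · subst hij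
      have hsq (ω : ι → ℤˣ) : ((ω i : ℤ) : ℝ) * (ω i : ℤ) = 1 := by
        rw [← Int.cast_mul, ← Units.val_mul, Int.units_mul_self, Units.val_one, Int.cast_one]
      simp only [hsq, mul_one, sum_signWeight]
    · simpa only [prod_pair hij] using sum_signWeight_mul_prod h {i, j}
  simp only [mul_sum]
  rw [sum_comm]
  refine sum_congr rfl fun i _ => ?_
  rw [sum_comm]
  refine sum_congr rfl fun j _ => ?_
  simp only [← moment, sum_mul, mul_assoc]

/-- Gibbs' variational principle, with the relative entropy of `signWeight h` estimated by
`∑ i, h i ^ 2`. -/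
lemma exp_sum_signWeight_mul_sub_le {h : ι → ℝ} (hh : ∀ i, |h i| ≤ 1) (φ : (ι → ℤˣ) → ℝ) :
    Real.exp (∑ ω, signWeight h ω * φ ω - ∑ i, h i ^ 2) ≤
      (∑ ω, Real.exp (φ ω)) / 2 ^ Fintype.card ι := by
  set tilt : (ι → ℤˣ) → ℝ := fun ω => φ ω - ∑ i, h i * (ω i : ℤ) with htilt
  have hmean : ∑ ω, signWeight h ω * tilt ω = ∑ ω, signWeight h ω * φ ω - ∑ i, h i ^ 2 := by
    simp only [htilt, mul_sub, sum_sub_distrib, sum_signWeight_mul_linear, sq]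
  calc Real.exp (∑ ω, signWeight h ω * φ ω - ∑ i, h i ^ 2)
      = Real.exp (∑ ω, signWeight h ω • tilt ω) := by simp only [smul_eq_mul, hmean]
    _ ≤ ∑ ω, signWeight h ω • Real.exp (tilt ω) :=
        convexOn_exp.map_sum_le (fun ω _ => signWeight_nonneg hh ω) (sum_signWeight h)
          fun _ _ => Set.mem_univ _
    _ ≤ ∑ ω, Real.exp (φ ω) / 2 ^ Fintype.card ι := by
        refine sum_le_sum fun ω _ => ?_
        calc signWeight h ω * Real.exp (tilt ω)
            ≤ Real.exp (∑ i, h i * (ω i : ℤ)) / 2 ^ Fintype.card ι * Real.exp (tilt ω) :=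
              mul_le_mul_of_nonneg_right (signWeight_le hh ω) (Real.exp_pos _).le
          _ = Real.exp (φ ω) / 2 ^ Fintype.card ι := by
              rw [div_mul_eq_mul_div, ← Real.exp_add, htilt, add_sub_cancel]
    _ = (∑ ω, Real.exp (φ ω)) / 2 ^ Fintype.card ι := (sum_div _ _ _).symm

lemma sum_sum_ite_mul_le {h : ι → ℝ} {C : ι → ι → ℝ} {L N : ℝ} (hL : 0 ≤ L)
    (hdiag : ∀ i, C i i ≤ N) (hoff : ∀ i j, i ≠ j → |C i j| ≤ L) :
    ∑ i, ∑ j, (if i = j then 1 else h i * h j) * C i j ≤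
      Fintype.card ι * N + L * Fintype.card ι * ∑ i, h i ^ 2 := by
  have hterm (i j : ι) : (if i = j then 1 else h i * h j) * C i j ≤
      (if i = j then N else 0) + L * (|h i| * |h j|) := by
    split_ifs with hij
    · subst hij
      nlinarith [hdiag i, mul_nonneg hL (mul_self_nonneg |h i|)]
    · rw [zero_add, ← abs_mul, mul_comm L]
      refine (le_abs_self _).trans ?_
      rw [abs_mul]
      exact mul_le_mul_of_nonneg_left (hoff i j hij) (abs_nonneg _)
  calc ∑ i, ∑ j, (if i = j then 1 else h i * h j) * C i j
      ≤ ∑ i, ∑ j, ((if i = j then N else 0) + L * (|h i| * |h j|)) :=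
        sum_le_sum fun i _ => sum_le_sum fun j _ => hterm i j
    _ = Fintype.card ι * N + L * (∑ i, |h i|) ^ 2 := by
        simp only [sum_add_distrib, sum_ite_eq, mem_univ, if_true, sum_const, card_univ,
          nsmul_eq_mul, sq, sum_mul_sum, ← mul_sum]
    _ ≤ Fintype.card ι * N + L * (Fintype.card ι * ∑ i, |h i| ^ 2) := by
        gcongr
        simpa using sq_sum_le_card_mul_sum_sq (s := univ) (f := fun i => |h i|)
    _ = _ := by simp only [sq_abs, mul_assoc]

/-- Testing Gibbs' principle with the sign biases `h i = μ * G i / 2` shows that averaging over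
random signs recovers the square function `∑ i, G i ^ 2`. -/
theorem exp_sum_sq_le_sum_exp_signs {G : ι → ℝ} {C : ι → ι → ℝ} {L N μ : ℝ} (hμ : 0 ≤ μ)
    (hG : ∀ i, |G i| ≤ L) (hL : 0 ≤ L)
    (hdiag : ∀ i, C i i ≤ N) (hoff : ∀ i j, i ≠ j → |C i j| ≤ L)
    (hμL : μ ^ 2 * (L * Fintype.card ι + L ^ 2) ≤ 1) :
    Real.exp (μ ^ 2 * (∑ i, G i ^ 2) / 8 - μ ^ 2 * (Fintype.card ι * N) / 2) ≤
      (∑ ω : ι → ℤˣ, Real.exp (μ * ∑ i, (ω i : ℤ) * G i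
        - μ ^ 2 / 2 * ∑ i, ∑ j, (ω i : ℤ) * (ω j : ℤ) * C i j)) / 2 ^ Fintype.card ι := by
  set m : ℝ := (Fintype.card ι : ℝ)
  have hm : 0 ≤ L * m := by positivity
  set h : ι → ℝ := fun i => μ / 2 * G i
  have hh (i : ι) : |h i| ≤ 1 := by
    have hμL1 : μ * L ≤ 1 := (sq_le_one_iff₀ (by positivity)).1 (by nlinarith)
    rw [abs_mul, abs_of_nonneg (by positivity)]
    nlinarith [hG i, abs_nonneg (G i)]
  have hsq : ∑ i, h i ^ 2 = μ ^ 2 / 4 * ∑ i, G i ^ 2 := by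
    rw [mul_sum]
    exact sum_congr rfl fun i _ => by ring
  have hquad := sum_sum_ite_mul_le (h := h) hL hdiag hoff
  refine le_trans (Real.exp_le_exp.2 ?_) (exp_sum_signWeight_mul_sub_le hh _)
  have hlin : ∑ ω, signWeight h ω * ∑ i, (ω i : ℤ) * G i = μ / 2 * ∑ i, G i ^ 2 := by
    simp only [mul_comm _ (G _), sum_signWeight_mul_linear]
    rw [mul_sum]
    exact sum_congr rfl fun i _ => by ring
  simp only [mul_sub, mul_left_comm (signWeight _ _), sum_sub_distrib, ← mul_sum, hlin,
    sum_signWeight_mul_quadratic, hsq] at hquad ⊢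
  have hS : 0 ≤ ∑ i, G i ^ 2 := sum_nonneg fun i _ => sq_nonneg _
  have hLm : μ ^ 2 * (L * m) ≤ 1 := by nlinarith [mul_nonneg (sq_nonneg μ) (sq_nonneg L)]
  nlinarith [mul_le_mul_of_nonneg_left hquad (sq_nonneg μ),
    mul_le_mul_of_nonneg_right hLm (mul_nonneg (sq_nonneg μ) hS)]

end Signs

/-! ### The square function of a family of martingales -/

section SquareFunction

lemma lintegral_average_le_one {α β : Type*} [MeasurableSpace α] {P : Measure α} [Fintype β]
    [Nonempty β] {ψ : β → α → ℝ} (hψ : ∀ b, Measurable (ψ b)) (hψ0 : ∀ b x, 0 ≤ ψ b x)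
    (hψ1 : ∀ b, ∫⁻ x, ENNReal.ofReal (ψ b x) ∂P ≤ 1) :
    ∫⁻ x, ENNReal.ofReal ((∑ b, ψ b x) / Fintype.card β) ∂P ≤ 1 := by
  have hβ : (0 : ℝ) < Fintype.card β := by exact_mod_cast Fintype.card_pos
  simp only [ENNReal.ofReal_div_of_pos hβ, ENNReal.ofReal_sum_of_nonneg fun b _ => hψ0 b _,
    ENNReal.div_eq_inv_mul, ENNReal.ofReal_natCast]
  rw [lintegral_const_mul _ (Finset.measurable_fun_sum _ fun b _ => (hψ b).ennreal_ofReal),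
    lintegral_finsetSum _ fun b _ => (hψ b).ennreal_ofReal]
  calc (Fintype.card β : ENNReal)⁻¹ * ∑ b, ∫⁻ x, ENNReal.ofReal (ψ b x) ∂P
      ≤ (Fintype.card β : ENNReal)⁻¹ * ∑ _b : β, 1 := by gcongr; exact hψ1 _
    _ ≤ 1 := by simp

variable {ι κ : Type*} [Fintype ι] {A : Finset κ} {ℓ : κ → ℕ} {g : ι → κ → ℝ → ℝ}

lemma lintegral_exp_signs_le_one (hℓ : Set.InjOn ℓ A)
    (hg : ∀ i, ∀ a ∈ A, g i a ∈ haarSpace (ℓ a)) (μ : ℝ) (ω : ι → ℤˣ) :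
    ∫⁻ x, ENNReal.ofReal (Real.exp (μ * ∑ i, (ω i : ℤ) * ∑ a ∈ A, g i a x
      - μ ^ 2 / 2 * ∑ i, ∑ j, (ω i : ℤ) * (ω j : ℤ) * ∑ a ∈ A, g i a x * g j a x))
      ∂unitMeasure ≤ 1 := by
  set D : κ → ℝ → ℝ := fun a => μ • ∑ i, ((ω i : ℤ) : ℝ) • g i a with hD
  have hDmem : ∀ a ∈ A, D a ∈ haarSpace (ℓ a) := fun a ha =>
    Submodule.smul_mem _ _ (Submodule.sum_mem _ fun i _ => Submodule.smul_mem _ _ (hg i a ha))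
  have hDapp (a : κ) (x : ℝ) : D a x = μ * ∑ i, (ω i : ℤ) * g i a x := by
    simp [hD, Finset.sum_apply]
  have hlin (x : ℝ) : ∑ a ∈ A, D a x = μ * ∑ i, (ω i : ℤ) * ∑ a ∈ A, g i a x := by
    simp only [hDapp, ← mul_sum]
    rw [sum_comm]
    simp only [← mul_sum]
  have hquad (x : ℝ) : ∑ a ∈ A, D a x ^ 2 =
      μ ^ 2 * ∑ i, ∑ j, (ω i : ℤ) * (ω j : ℤ) * ∑ a ∈ A, g i a x * g j a x := by
    simp only [hDapp, mul_pow, ← mul_sum, sq (Finset.sum _ _), sum_mul_sum]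
    congr 1
    rw [sum_comm]
    refine sum_congr rfl fun _ _ => ?_
    simp only [mul_sum]
    rw [sum_comm]
    exact sum_congr rfl fun _ _ => sum_congr rfl fun _ _ => mul_mul_mul_comm _ _ _ _
  have hD1 := lintegral_exp_sum_sub_sq_le_one hℓ hDmem
  simp only [sum_sub_distrib, ← sum_div, hlin, hquad] at hD1
  simpa only [div_mul_eq_mul_div] using hD1

theorem unitMeasure_lt_sum_sq_sum_le {L N V u : ℝ} (hℓ : Set.InjOn ℓ A)
    (hg : ∀ i, ∀ a ∈ A, g i a ∈ haarSpace (ℓ a)) (hN : ∀ i x, ∑ a ∈ A, g i a x ^ 2 ≤ N)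
    (hL : 0 < L) (hV : 4 * Fintype.card ι * N + 8 * u * (L * Fintype.card ι + L ^ 2) ≤ V) :
    unitMeasure {x | (∀ i, |∑ a ∈ A, g i a x| ≤ L) ∧
        (∀ i j, i ≠ j → |∑ a ∈ A, g i a x * g j a x| ≤ L) ∧
        V < ∑ i, (∑ a ∈ A, g i a x) ^ 2} ≤ ENNReal.ofReal (Real.exp (-u)) := by
  classical
  set Λ : ℝ := L * Fintype.card ι + L ^ 2
  have hΛ0 : 0 < Λ := by positivity
  set μ : ℝ := (√Λ)⁻¹
  have hμ : μ ^ 2 * Λ = 1 := by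
    rw [inv_pow, Real.sq_sqrt hΛ0.le, inv_mul_cancel₀ hΛ0.ne']
  set ψ : (ι → ℤˣ) → ℝ → ℝ := fun ω x => Real.exp (μ * ∑ i, (ω i : ℤ) * ∑ a ∈ A, g i a x
    - μ ^ 2 / 2 * ∑ i, ∑ j, (ω i : ℤ) * (ω j : ℤ) * ∑ a ∈ A, g i a x * g j a x)
  have hψm (ω : ι → ℤˣ) : Measurable (ψ ω) := by
    have hgm (i : ι) : ∀ a ∈ A, Measurable (g i a) :=
      fun a ha => measurable_of_mem_haarSpace (hg i a ha)
    refine ((measurable_const.mul (Finset.measurable_fun_sum _ fun i _ => measurable_const.mul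
      (Finset.measurable_fun_sum A (hgm i)))).sub (measurable_const.mul
      (Finset.measurable_fun_sum _ fun i _ => Finset.measurable_fun_sum _ fun j _ =>
        measurable_const.mul (Finset.measurable_fun_sum A fun a ha =>
          (hgm i a ha).mul (hgm j a ha))))).exp
  have hint : ∫⁻ x, ENNReal.ofReal ((∑ ω, ψ ω x) / 2 ^ Fintype.card ι) ∂unitMeasure ≤ 1 := by
    simpa using lintegral_average_le_one hψm (fun ω x => (Real.exp_pos _).le)
      (lintegral_exp_signs_le_one hℓ hg μ)
  refine (measure_mono fun x hx => ?_).trans (measure_exp_le_le_exp_neg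
    ((Finset.measurable_fun_sum univ fun ω _ => hψm ω).div_const _) hint u)
  obtain ⟨hrow, hcorr, hsq⟩ := hx
  refine le_trans (Real.exp_le_exp.2 ?_)
    (exp_sum_sq_le_sum_exp_signs (by positivity) hrow hL.le
      (fun i => by simpa only [← sq] using hN i x) hcorr hμ.le)
  have : μ ^ 2 * (4 * Fintype.card ι * N + 8 * u * Λ) ≤ μ ^ 2 * ∑ i, (∑ a ∈ A, g i a x) ^ 2 :=
    mul_le_mul_of_nonneg_left (hV.trans hsq.le) (sq_nonneg _)
  linear_combination this / 8 - u * hμ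

end SquareFunction

/-! ### Fubini and functions on the cube -/

lemma measurePi_le_of_forall_update_le {ι : Type*} [Fintype ι] [DecidableEq ι] {X : ι → Type*}
    [∀ i, MeasurableSpace (X i)] (P : ∀ i, Measure (X i)) [∀ i, IsProbabilityMeasure (P i)]
    {S : Set (∀ i, X i)} (hS : MeasurableSet S) (i : ι) {B : ENNReal}
    (hB : ∀ x, P i {y | Function.update x i y ∈ S} ≤ B) : Measure.pi P S ≤ B := by
  obtain ⟨x⟩ : Nonempty (∀ i, X i) := nonempty_of_isProbabilityMeasure (Measure.pi P)
  have hslice (z : ∀ i, X i) : ∫⁻ y, S.indicator 1 (Function.update z i y) ∂P i ≤ B := by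
    refine le_trans (le_of_eq ?_) (hB z)
    exact lintegral_indicator_one (measurable_update z hS)
  calc Measure.pi P S = ∫⁻ z, S.indicator 1 z ∂Measure.pi P := (lintegral_indicator_one hS).symm
    _ = (∫⋯∫⁻_univ.erase i, (fun z => ∫⁻ y, S.indicator 1 (Function.update z i y) ∂P i) ∂P) x := by
        rw [lintegral_eq_lmarginal_univ x,
          lmarginal_erase' _ (measurable_one.indicator hS) (mem_univ i)]
    _ ≤ (∫⋯∫⁻_univ.erase i, (fun _ => B) ∂P) x := lmarginal_mono hslice x
    _ = B := by simp [lmarginal]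

lemma cubeMeasure_eq_pi : cubeMeasure = Measure.pi fun _ => unitMeasure := by
  have h : (Set.univ.pi fun _ => Set.Ico 0 1 : Set (Fin 3 → ℝ)) =ᵐ[volume] Set.Icc 0 1 :=
    Measure.univ_pi_Ico_ae_eq_Icc
  rw [cubeMeasure, ← Measure.restrict_congr_set h, volume_pi, Measure.restrict_pi_pi]

instance : IsProbabilityMeasure cubeMeasure := by
  rw [cubeMeasure_eq_pi]
  infer_instance

lemma cubeMeasure_le_of_forall_update_le {S : Set (Fin 3 → ℝ)} (hS : MeasurableSet S) (i : Fin 3)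
    {B : ENNReal} (hB : ∀ x, unitMeasure {y | Function.update x i y ∈ S} ≤ B) :
    cubeMeasure S ≤ B := by
  rw [cubeMeasure_eq_pi]
  exact measurePi_le_of_forall_update_le _ hS i hB

/-- A measurable function that lies in `haarSpace (r i)` in its `i`-th variable, for each `i`, and
is bounded by `1`. This is the class of `r`-functions with arbitrary coefficients `|ε_R| ≤ 1`
instead of signs, extended to the whole space. -/
structure IsBoundedRFunction {ι : Type*} [DecidableEq ι] (r : ι → ℕ) (f : (ι → ℝ) → ℝ) : Prop where
  measurable : Measurable f
  abs_le_one : ∀ x, |f x| ≤ 1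
  slice_mem : ∀ i x, (fun y => f (Function.update x i y)) ∈ haarSpace (r i)

lemma isBoundedRFunction_zero {ι : Type*} [DecidableEq ι] (r : ι → ℕ) :
    IsBoundedRFunction r (0 : (ι → ℝ) → ℝ) :=
  ⟨measurable_zero, by simp, fun _ _ => Submodule.zero_mem _⟩

section RFunction

variable {r : Fin 3 → ℕ}

lemma measurable_haarRect (R : Rect r) : Measurable (haarRect r R) :=
  Finset.measurable_fun_prod _ fun i _ =>
    (measurable_of_mem_haarSpace (haar_mem_haarSpace (r i) (R i))).comp (measurable_pi_apply i)

lemma haarRect_update_mem_haarSpace (R : Rect r) (i : Fin 3) (x : Fin 3 → ℝ) :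
    (fun y => haarRect r R (Function.update x i y)) ∈ haarSpace (r i) := by
  have h (y : ℝ) : haarRect r R (Function.update x i y) =
      (∏ j ∈ univ.erase i, haar (r j) (R j) (x j)) * haar (r i) (R i) y := by
    rw [haarRect, ← prod_erase_mul _ _ (mem_univ i), Function.update_self]
    congr 1
    exact prod_congr rfl fun j hj => by rw [Function.update_of_ne (ne_of_mem_erase hj)]
  simp only [h]
  exact Submodule.smul_mem _ _ (haar_mem_haarSpace _ _)

lemma sum_abs_haarRect_le_one (x : Fin 3 → ℝ) : ∑ R : Rect r, |haarRect r R x| ≤ 1 := by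
  have h := prod_univ_sum (fun i => (univ : Finset (Fin (2 ^ r i))))
    fun i j => |haar (r i) j (x i)|
  rw [Fintype.piFinset_univ] at h
  simp only [haarRect, abs_prod]
  rw [← h]
  exact prod_le_one (fun i _ => sum_nonneg fun _ _ => abs_nonneg _)
    fun i _ => sum_abs_haar_le_one _ _

theorem isBoundedRFunction_of_isRFunction {f : (Fin 3 → ℝ) → ℝ} (hf : IsRFunction r f) :
    IsBoundedRFunction r f := by
  obtain ⟨ε, hε, hf⟩ := hf
  obtain rfl : f = fun x => ∑ R, ε R * haarRect r R x := funext hf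
  refine ⟨Finset.measurable_fun_sum _ fun R _ => (measurable_haarRect R).const_mul _,
    fun x => ?_, fun i x => ?_⟩
  · have hε1 (R : Rect r) : |ε R| = 1 := by rcases hε R with h | h <;> simp [h]
    calc |∑ R, ε R * haarRect r R x| ≤ ∑ R, |ε R * haarRect r R x| := abs_sum_le_sum_abs _ _
      _ = ∑ R, |haarRect r R x| := by simp only [abs_mul, hε1, one_mul]
      _ ≤ 1 := sum_abs_haarRect_le_one x
  · have h : (fun y => ∑ R, ε R * haarRect r R (Function.update x i y)) =
        ∑ R, ε R • fun y => haarRect r R (Function.update x i y) := by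
      ext y
      simp
    rw [h]
    exact Submodule.sum_mem _ fun R _ =>
      Submodule.smul_mem _ _ (haarRect_update_mem_haarSpace R i x)

end RFunction

/-! ### Row sums and their correlations -/

section Rows

variable {n : ℕ} {f : (Fin 3 → ℕ) → (Fin 3 → ℝ) → ℝ}

lemma mem_hyperbolicVectors {r : Fin 3 → ℕ} : r ∈ hyperbolicVectors n ↔ r 0 + r 1 + r 2 = n := by
  rw [hyperbolicVectors, Finset.Nat.mem_antidiagonalTuple, Fin.sum_univ_three]

/-- The function attached to the hyperbolic vector with first coordinates `s` and `a`, extended by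
zero to the pairs with `n < s + a`, so that all rows are indexed by the same range of `a`. -/
def hyperbolicTerm (n : ℕ) (f : (Fin 3 → ℕ) → (Fin 3 → ℝ) → ℝ) (s a : ℕ) : (Fin 3 → ℝ) → ℝ :=
  if s + a ≤ n then f ![s, a, n - s - a] else 0

/-- The sum of `f r` over the hyperbolic vectors `r` with first coordinate `s`. -/
def rowSum (n : ℕ) (f : (Fin 3 → ℕ) → (Fin 3 → ℝ) → ℝ) (s : ℕ) (x : Fin 3 → ℝ) : ℝ :=
  ∑ a ∈ range (n + 1), hyperbolicTerm n f s a x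

/-- The sum of `f r * f r'` over the pairs of hyperbolic vectors `r, r'` with first coordinates `s`
and `t` and equal second coordinates. -/
def rowCorrelation (n : ℕ) (f : (Fin 3 → ℕ) → (Fin 3 → ℝ) → ℝ) (s t : ℕ) (x : Fin 3 → ℝ) : ℝ :=
  ∑ a ∈ range (n + 1), hyperbolicTerm n f s a x * hyperbolicTerm n f t a x

lemma rowCorrelation_comm (s t : ℕ) : rowCorrelation n f s t = rowCorrelation n f t s :=
  funext fun _ => sum_congr rfl fun _ _ => mul_comm _ _

lemma blockSum_eq_sum_rowSum (J : Finset ℕ) (x : Fin 3 → ℝ) :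
    blockSum n J f x = ∑ s ∈ J, rowSum n f s x := by
  have hterm (s a : ℕ) : hyperbolicTerm n f s a x =
      if s + a ≤ n then f ![s, a, n - s - a] x else 0 := by
    unfold hyperbolicTerm
    split_ifs <;> rfl
  have hvec {r : Fin 3 → ℕ} (hr : r 0 + r 1 + r 2 = n) : ![r 0, r 1, n - r 0 - r 1] = r := by
    ext i
    fin_cases i <;> simp
    omega
  simp only [rowSum, hterm]
  rw [← sum_product', ← sum_filter, blockSum]
  refine sum_nbij' (fun r => (r 0, r 1)) (fun p => ![p.1, p.2, n - p.1 - p.2]) ?_ ?_ ?_ ?_ ?_ <;>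
    simp only [mem_filter, mem_hyperbolicVectors, mem_product, mem_range]
  · exact fun r hr => ⟨⟨hr.2, by omega⟩, by omega⟩
  · exact fun p hp => ⟨by simp; omega, hp.1.1⟩
  · exact fun r hr => hvec hr.1
  · exact fun p _ => rfl
  · exact fun r hr => by rw [hvec hr.1]

variable (hf : ∀ r ∈ hyperbolicVectors n, IsBoundedRFunction r (f r))
include hf

lemma isBoundedRFunction_hyperbolicTerm (s a : ℕ) :
    IsBoundedRFunction ![s, a, n - s - a] (hyperbolicTerm n f s a) := by
  unfold hyperbolicTerm
  split_ifs with h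
  · exact hf _ (mem_hyperbolicVectors.2 (by simp; omega))
  · exact isBoundedRFunction_zero _

lemma measurable_rowSum (s : ℕ) : Measurable (rowSum n f s) :=
  Finset.measurable_fun_sum _ fun a _ => (isBoundedRFunction_hyperbolicTerm hf s a).measurable

lemma measurable_rowCorrelation (s t : ℕ) : Measurable (rowCorrelation n f s t) :=
  Finset.measurable_fun_sum _ fun a _ => (isBoundedRFunction_hyperbolicTerm hf s a).measurable.mul
    (isBoundedRFunction_hyperbolicTerm hf t a).measurable

lemma measurable_blockSum (J : Finset ℕ) : Measurable (blockSum n J f) := by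
  rw [funext (blockSum_eq_sum_rowSum J)]
  exact Finset.measurable_fun_sum J fun s _ => measurable_rowSum hf s

lemma abs_hyperbolicTerm_le_one (s a : ℕ) (x : Fin 3 → ℝ) : |hyperbolicTerm n f s a x| ≤ 1 :=
  (isBoundedRFunction_hyperbolicTerm hf s a).abs_le_one x

lemma rowSum_update_zero_mem_haarSpace (s : ℕ) (x : Fin 3 → ℝ) :
    (fun y => rowSum n f s (Function.update x 0 y)) ∈ haarSpace s := by
  have h : (fun y => rowSum n f s (Function.update x 0 y)) =
      ∑ a ∈ range (n + 1), fun y => hyperbolicTerm n f s a (Function.update x 0 y) := by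
    ext y
    simp [rowSum]
  rw [h]
  exact Submodule.sum_mem _ fun a _ => (isBoundedRFunction_hyperbolicTerm hf s a).slice_mem 0 x

lemma hyperbolicTerm_update_one_mem_haarSpace (s a : ℕ) (x : Fin 3 → ℝ) :
    (fun y => hyperbolicTerm n f s a (Function.update x 1 y)) ∈ haarSpace a :=
  (isBoundedRFunction_hyperbolicTerm hf s a).slice_mem 1 x

lemma mul_hyperbolicTerm_update_two_mem_haarSpace {s t a : ℕ} (hst : s < t) (hta : t + a ≤ n)
    (x : Fin 3 → ℝ) :
    (fun y => hyperbolicTerm n f s a (Function.update x 2 y) *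
      hyperbolicTerm n f t a (Function.update x 2 y)) ∈ haarSpace (n - s - a) :=
  mul_mem_haarSpace (show n - t - a < n - s - a by omega)
    ((isBoundedRFunction_hyperbolicTerm hf s a).slice_mem 2 x)
    ((isBoundedRFunction_hyperbolicTerm hf t a).slice_mem 2 x)

lemma cubeMeasure_lt_abs_rowSum_le {L : ℝ} (hL : 0 ≤ L) (s : ℕ) :
    cubeMeasure {x | L < |rowSum n f s x|} ≤
      ENNReal.ofReal (2 * Real.exp (-(L ^ 2 / (2 * (n + 1))))) :=
  cubeMeasure_le_of_forall_update_le
    (measurableSet_lt measurable_const (measurable_rowSum hf s).abs) 1 fun x =>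
    unitMeasure_lt_abs_sum_le (ℓ := id) (Set.injOn_id _)
      (fun a _ => hyperbolicTerm_update_one_mem_haarSpace hf s a x)
      (fun a _ y => abs_hyperbolicTerm_le_one hf s a _) (by simp) hL (by positivity)

lemma cubeMeasure_lt_abs_rowCorrelation_le {L : ℝ} (hL : 0 ≤ L) {s t : ℕ} (hst : s ≠ t) :
    cubeMeasure {x | L < |rowCorrelation n f s t x|} ≤
      ENNReal.ofReal (2 * Real.exp (-(L ^ 2 / (2 * (n + 1))))) := by
  wlog hlt : s < t generalizing s t
  · rw [rowCorrelation_comm]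
    exact this hst.symm (by omega)
  have hsum (x : Fin 3 → ℝ) : rowCorrelation n f s t x =
      ∑ a ∈ range (n + 1) with t + a ≤ n, hyperbolicTerm n f s a x * hyperbolicTerm n f t a x := by
    refine (sum_filter_of_ne fun a _ h => ?_).symm
    by_contra hta
    simp [hyperbolicTerm, hta] at h
  refine cubeMeasure_le_of_forall_update_le
    (measurableSet_lt measurable_const (measurable_rowCorrelation hf s t).abs) 2 fun x => ?_
  simp only [Set.mem_ofPred_eq, hsum]
  refine unitMeasure_lt_abs_sum_le (ℓ := fun a => n - s - a)
    (fun a ha b hb hab => ?_) (fun a ha => ?_) (fun a _ y => ?_) ?_ hL (by positivity)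
  · simp only [coe_filter, Set.mem_ofPred_eq] at ha hb hab
    omega
  · exact mul_hyperbolicTerm_update_two_mem_haarSpace hf hlt (mem_filter.1 ha).2 x
  · rw [abs_mul]
    exact mul_le_one₀ (abs_hyperbolicTerm_le_one hf s a _) (abs_nonneg _)
      (abs_hyperbolicTerm_le_one hf t a _)
  · exact_mod_cast (card_filter_le _ _).trans (card_range _).le

lemma cubeMeasure_lt_sum_sq_rowSum_le (J : Finset ℕ) {L V u : ℝ} (hL : 0 < L)
    (hV : 4 * #J * (n + 1) + 8 * u * (L * #J + L ^ 2) ≤ V) :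
    cubeMeasure {x | (∀ s : J, |rowSum n f s x| ≤ L) ∧
        (∀ s t : J, s ≠ t → |rowCorrelation n f s t x| ≤ L) ∧
        V < ∑ s : J, rowSum n f s x ^ 2} ≤ ENNReal.ofReal (Real.exp (-u)) := by
  have hmeas : MeasurableSet {x | (∀ s : J, |rowSum n f s x| ≤ L) ∧
      (∀ s t : J, s ≠ t → |rowCorrelation n f s t x| ≤ L) ∧
      V < ∑ s : J, rowSum n f s x ^ 2} := by
    have hrow := measurable_rowSum hf
    have hcorr := measurable_rowCorrelation hf
    simp only [Set.ofPred_and, Set.ofPred_forall]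
    measurability
  refine cubeMeasure_le_of_forall_update_le hmeas 1 fun x => ?_
  refine unitMeasure_lt_sum_sq_sum_le (ℓ := id) (N := n + 1) (Set.injOn_id _)
    (fun s a _ => hyperbolicTerm_update_one_mem_haarSpace hf s a x) (fun s y => ?_) hL
    (by simpa using hV)
  calc ∑ a ∈ range (n + 1), hyperbolicTerm n f s a (Function.update x 1 y) ^ 2
      ≤ ∑ _a ∈ range (n + 1), (1 : ℝ) := sum_le_sum fun a _ =>
        (sq_le_one_iff_abs_le_one _).2 (abs_hyperbolicTerm_le_one hf s a _)
    _ = n + 1 := by simp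

lemma cubeMeasure_sum_sq_rowSum_le_and_lt_abs_blockSum_le (J : Finset ℕ) {y V : ℝ} (hy : 0 ≤ y)
    (hV : 0 < V) :
    cubeMeasure {x | ∑ s ∈ J, rowSum n f s x ^ 2 ≤ V ∧ y < |blockSum n J f x|} ≤
      ENNReal.ofReal (2 * Real.exp (-(y ^ 2 / (2 * V)))) := by
  refine cubeMeasure_le_of_forall_update_le ((measurableSet_le (Finset.measurable_fun_sum J
    fun s _ => (measurable_rowSum hf s).pow_const 2) measurable_const).inter
    (measurableSet_lt measurable_const (measurable_blockSum hf J).abs)) 0 fun x => ?_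
  simp only [blockSum_eq_sum_rowSum]
  exact unitMeasure_sum_sq_le_and_lt_abs_sum_le (ℓ := id) (Set.injOn_id _)
    (fun s _ => rowSum_update_zero_mem_haarSpace hf s x) hy hV

lemma cubeMeasure_exists_lt_abs_row_le (J : Finset ℕ) {L : ℝ} (hL : 0 ≤ L) :
    cubeMeasure ((⋃ s ∈ J, {x | L < |rowSum n f s x|}) ∪
        ⋃ p ∈ J.offDiag, {x | L < |rowCorrelation n f p.1 p.2 x|}) ≤
      ENNReal.ofReal (2 * (#J + #J ^ 2) * Real.exp (-(L ^ 2 / (2 * (n + 1))))) := by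
  have hsums := measure_biUnion_finset_le (μ := cubeMeasure) J fun s => {x | L < |rowSum n f s x|}
  have hcorrs := measure_biUnion_finset_le (μ := cubeMeasure) J.offDiag
    fun p => {x | L < |rowCorrelation n f p.1 p.2 x|}
  set ε : ℝ := 2 * Real.exp (-(L ^ 2 / (2 * (n + 1))))
  have hε : 0 ≤ ε := by positivity
  have hoff : (#J.offDiag : ℝ) ≤ #J ^ 2 := by
    rw [offDiag_card, sq]
    exact_mod_cast Nat.sub_le _ _
  calc _ ≤ ∑ _s ∈ J, ENNReal.ofReal ε + ∑ _p ∈ J.offDiag, ENNReal.ofReal ε :=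
        (measure_union_le _ _).trans <| add_le_add
          (hsums.trans (sum_le_sum fun s _ => cubeMeasure_lt_abs_rowSum_le hf hL s))
          (hcorrs.trans (sum_le_sum fun p hp =>
            cubeMeasure_lt_abs_rowCorrelation_le hf hL (mem_offDiag.1 hp).2.2))
    _ = ENNReal.ofReal (#J * ε + #J.offDiag * ε) := by
        rw [ENNReal.ofReal_add (by positivity) (by positivity),
          ENNReal.ofReal_mul (Nat.cast_nonneg #J), ENNReal.ofReal_mul (Nat.cast_nonneg #J.offDiag)]
        simp only [sum_const, nsmul_eq_mul, ENNReal.ofReal_natCast]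
    _ ≤ ENNReal.ofReal (2 * (#J + #J ^ 2) * Real.exp (-(L ^ 2 / (2 * (n + 1))))) :=
        ENNReal.ofReal_le_ofReal <| by
          linarith [mul_le_mul_of_nonneg_right hoff hε]

theorem cubeMeasure_lt_abs_blockSum_le (J : Finset ℕ) {y L V u : ℝ} (hy : 0 ≤ y) (hL : 0 < L)
    (hV0 : 0 < V) (hV : 4 * #J * (n + 1) + 8 * u * (L * #J + L ^ 2) ≤ V) :
    cubeMeasure {x | y < |blockSum n J f x|} ≤
      ENNReal.ofReal (2 * Real.exp (-(y ^ 2 / (2 * V))) + Real.exp (-u)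
        + 2 * (#J + #J ^ 2) * Real.exp (-(L ^ 2 / (2 * (n + 1))))) := by
  set smallSquares := {x | ∑ s ∈ J, rowSum n f s x ^ 2 ≤ V ∧ y < |blockSum n J f x|}
  set largeSquares := {x | (∀ s : J, |rowSum n f s x| ≤ L) ∧
    (∀ s t : J, s ≠ t → |rowCorrelation n f s t x| ≤ L) ∧ V < ∑ s : J, rowSum n f s x ^ 2}
  set largeRow := (⋃ s ∈ J, {x | L < |rowSum n f s x|}) ∪
    ⋃ p ∈ J.offDiag, {x | L < |rowCorrelation n f p.1 p.2 x|}
  have hcover : {x | y < |blockSum n J f x|} ⊆ smallSquares ∪ largeSquares ∪ largeRow := by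
    intro x hx
    by_contra! hnot
    simp only [Set.mem_union, not_or] at hnot
    obtain ⟨⟨hsmall, hlarge⟩, hrow⟩ := hnot
    simp only [largeRow, Set.mem_union, Set.mem_iUnion, Set.mem_ofPred_eq, mem_offDiag, not_or,
      not_exists, not_lt] at hrow
    refine hlarge ⟨fun s => hrow.1 s s.2, fun s t hst => hrow.2 (s, t)
      ⟨s.2, t.2, fun h => hst (Subtype.ext h)⟩, ?_⟩
    rw [sum_coe_sort J fun s => rowSum n f s x ^ 2]
    exact lt_of_not_ge fun hle => hsmall ⟨hle, hx⟩
  rw [ENNReal.ofReal_add (by positivity) (by positivity),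
    ENNReal.ofReal_add (by positivity) (by positivity)]
  exact (measure_mono hcover).trans <| (measure_union_le _ _).trans <| add_le_add
    ((measure_union_le _ _).trans <| add_le_add
      (cubeMeasure_sum_sq_rowSum_le_and_lt_abs_blockSum_le hf J hy hV0)
      (cubeMeasure_lt_sum_sq_rowSum_le hf J hL hV))
    (cubeMeasure_exists_lt_abs_row_le hf J hL.le)

end Rows

/-! ### Choice of the parameters -/

section Parameters

variable {m ν q p w : ℝ}

lemma four_mul_add_eight_mul_le (hm : 0 ≤ m) (hν : 1 ≤ ν) (hq : 0 < q) (hqν : q ≤ ν)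
    (hmq : m * q ≤ 2 * ν ^ 3) (hpν : p ≤ ν) (hw : 1 ≤ w) :
    4 * m * (ν ^ 3 + 1) + 8 * (p * w) * (3 * ν ^ 2 * w * m + (3 * ν ^ 2 * w) ^ 2) ≤
      200 * ν ^ 6 * w ^ 3 / q := by
  have hw₂ : w ^ 2 ≤ w ^ 3 := pow_le_pow_right₀ hw (by norm_num)
  have hw₃ : 1 ≤ w ^ 3 := one_le_pow₀ hw
  have hν₃ : 1 ≤ ν ^ 3 := one_le_pow₀ hν
  have hdiag : 4 * (m * q) * (ν ^ 3 + 1) ≤ 16 * ν ^ 6 * w ^ 3 :=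
    calc 4 * (m * q) * (ν ^ 3 + 1) ≤ 4 * (2 * ν ^ 3) * (2 * ν ^ 3) := by gcongr; linarith
      _ = 16 * ν ^ 6 * 1 := by ring
      _ ≤ 16 * ν ^ 6 * w ^ 3 := by gcongr
  have hlin : 24 * p * ν ^ 2 * w ^ 2 * (m * q) ≤ 48 * ν ^ 6 * w ^ 3 :=
    calc 24 * p * ν ^ 2 * w ^ 2 * (m * q) ≤ 24 * ν * ν ^ 2 * w ^ 3 * (2 * ν ^ 3) := by gcongr
      _ = 48 * ν ^ 6 * w ^ 3 := by ring
  have hquad : 72 * p * ν ^ 4 * w ^ 3 * q ≤ 72 * ν ^ 6 * w ^ 3 :=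
    calc 72 * p * ν ^ 4 * w ^ 3 * q ≤ 72 * ν * ν ^ 4 * w ^ 3 * ν := by gcongr
      _ = 72 * ν ^ 6 * w ^ 3 := by ring
  rw [le_div_iff₀ hq]
  have : 0 ≤ ν ^ 6 * w ^ 3 := by positivity
  linarith

lemma sq_add_mul_exp_neg_le (hm : 0 ≤ m) (hmν : m ≤ 2 * ν ^ 3) (hν : 1 ≤ ν) (hw : 1 ≤ w) :
    2 * (m + m ^ 2) * Real.exp (-((3 * ν ^ 2 * w) ^ 2 / (2 * (ν ^ 3 + 1)))) ≤
      8640 * Real.exp (-(ν * w)) := by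
  have hν₃ : 1 ≤ ν ^ 3 := one_le_pow₀ hν
  have hcount : 2 * (m + m ^ 2) ≤ 12 * ν ^ 6 := by nlinarith
  have hexponent : 2 * (ν * w) ≤ (3 * ν ^ 2 * w) ^ 2 / (2 * (ν ^ 3 + 1)) := by
    rw [le_div_iff₀ (by positivity)]
    calc 2 * (ν * w) * (2 * (ν ^ 3 + 1)) ≤ 2 * (ν * w) * (2 * (ν ^ 3 + ν ^ 3)) := by gcongr
      _ = 8 * ν ^ 4 * w * 1 := by ring
      _ ≤ 9 * ν ^ 4 * w * w := by gcongr; norm_num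
      _ = (3 * ν ^ 2 * w) ^ 2 := by ring
  have hpow : ν ^ 6 ≤ 720 * Real.exp (ν * w) := by
    have h := Real.pow_div_factorial_le_exp (ν * w) (by positivity) 6
    rw [div_le_iff₀ (by positivity),
      show (Nat.factorial 6 : ℝ) = 720 by norm_num [Nat.factorial]] at h
    calc ν ^ 6 ≤ (ν * w) ^ 6 := by gcongr; nlinarith
      _ ≤ 720 * Real.exp (ν * w) := by linarith
  calc 2 * (m + m ^ 2) * Real.exp (-((3 * ν ^ 2 * w) ^ 2 / (2 * (ν ^ 3 + 1))))
      ≤ 12 * (720 * Real.exp (ν * w)) * Real.exp (-(2 * (ν * w))) := by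
        refine mul_le_mul (by linarith) ?_ (by positivity) (by positivity)
        gcongr
    _ = 8640 * (Real.exp (ν * w) * Real.exp (-(2 * (ν * w)))) := by ring
    _ = 8640 * Real.exp (-(ν * w)) := by rw [← Real.exp_add]; ring_nf

end Parameters

section BlockSum

variable {n q : ℕ} {f : (Fin 3 → ℕ) → (Fin 3 → ℝ) → ℝ}

lemma lt_abs_rho_mul_iff {y b : ℝ} (hn : 0 < n) (hq : 0 < q) :
    y < |rho n q * b| ↔ y * (n / √q) < |b| := by
  rw [rho, abs_mul, abs_of_pos (by positivity : 0 < √(q : ℝ) / n), ← div_lt_iff₀' (by positivity),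
    div_div_eq_mul_div, mul_div_assoc]

theorem cubeMeasure_lt_abs_rho_mul_blockSum_le
    (hf : ∀ r ∈ hyperbolicVectors n, IsBoundedRFunction r (f r)) {J : Finset ℕ} (hq : 0 < q)
    (hqn : q ^ 3 ≤ n) (hJ : #J * q ≤ 2 * n) {p w : ℝ} (hp : 1 ≤ p)
    (hpn : p ≤ (n : ℝ) ^ (1 / 3 : ℝ)) (hw : 1 ≤ w) :
    cubeMeasure {x | 20 * √p * w ^ 2 < |rho n q * blockSum n J f x|} ≤
      ENNReal.ofReal (8643 * Real.exp (-(p * w))) := by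
  have hn : 0 < n := (pow_pos hq 3).trans_le hqn
  obtain ⟨ν, hν, hνn⟩ : ∃ ν : ℝ, ν = (n : ℝ) ^ (1 / 3 : ℝ) ∧ ν ^ 3 = n :=
    ⟨_, rfl, by rw [← Real.rpow_natCast, ← Real.rpow_mul n.cast_nonneg]; norm_num⟩
  rw [← hν] at hpn
  have hν₁ : 1 ≤ ν := hp.trans hpn
  have hq₁ : (1 : ℝ) ≤ q := by exact_mod_cast hq
  have hqν : (q : ℝ) ≤ ν := by
    refine le_of_pow_le_pow_left₀ three_ne_zero (by positivity) ?_
    rw [hνn]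
    exact_mod_cast hqn
  have hJν : (#J : ℝ) * q ≤ 2 * ν ^ 3 := by
    rw [hνn]
    exact_mod_cast hJ
  have hV := four_mul_add_eight_mul_le (#J).cast_nonneg hν₁ (by positivity) hqν hJν hpn hw
  have hrows := sq_add_mul_exp_neg_le (#J).cast_nonneg
    ((le_mul_of_one_le_right (#J).cast_nonneg hq₁).trans hJν) hν₁ hw
  have hgauss : (20 * √p * w ^ 2 * (n / √q)) ^ 2 / (2 * (200 * ν ^ 6 * w ^ 3 / q)) = p * w := by
    rw [← hνn]
    field_simp
    rw [Real.sq_sqrt (by positivity), Real.sq_sqrt (by positivity)]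
    ring
  have hpν : Real.exp (-(ν * w)) ≤ Real.exp (-(p * w)) := by gcongr
  rw [hνn] at hV hrows
  simp only [lt_abs_rho_mul_iff hn hq]
  refine (cubeMeasure_lt_abs_blockSum_le hf J (by positivity) (by positivity) (by positivity)
    hV).trans (ENNReal.ofReal_le_ofReal ?_)
  rw [hgauss]
  linarith

end BlockSum

/-! ### Moments from tails -/

section Moments

variable {α E : Type*} [MeasurableSpace α] {P : Measure α} [NormedAddCommGroup E] {g : α → E}
  {a p : ℝ}

lemma eLpNorm_le_of_lintegral_exp_sqrt_le (ha : 0 < a) (hp : 0 < p) {B : ℝ} (hB : 0 ≤ B)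
    (h : ∫⁻ x, ENNReal.ofReal (Real.exp (p / 2 * √(‖g x‖ / a))) ∂P ≤ ENNReal.ofReal (B ^ p)) :
    eLpNorm g (ENNReal.ofReal p) P ≤ ENNReal.ofReal (8 * a * B) := by
  have hnorm (x : α) : ‖g x‖ ≤ 8 * a * Real.exp (√(‖g x‖ / a) / 2) := by
    have hexp := Real.pow_div_factorial_le_exp (√(‖g x‖ / a) / 2) (by positivity) 2
    rw [div_pow, Real.sq_sqrt (by positivity), div_div, div_div, div_le_iff₀ (by positivity),
      Nat.factorial_two, Nat.cast_ofNat] at hexp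
    linarith
  have hpoint (x : α) : ‖g x‖ₑ ^ p ≤
      ENNReal.ofReal ((8 * a) ^ p) * ENNReal.ofReal (Real.exp (p / 2 * √(‖g x‖ / a))) := by
    rw [← ofReal_norm, ENNReal.ofReal_rpow_of_nonneg (norm_nonneg _) hp.le,
      ← ENNReal.ofReal_mul (by positivity)]
    refine ENNReal.ofReal_le_ofReal ?_
    calc ‖g x‖ ^ p ≤ (8 * a * Real.exp (√(‖g x‖ / a) / 2)) ^ p := by
          gcongr
          exact hnorm x
      _ = (8 * a) ^ p * Real.exp (p / 2 * √(‖g x‖ / a)) := by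
          rw [Real.mul_rpow (by positivity) (by positivity), ← Real.exp_mul]
          ring_nf
  rw [eLpNorm_eq_lintegral_rpow_enorm_toReal (by simpa using hp) ENNReal.ofReal_ne_top,
    ENNReal.toReal_ofReal hp.le, one_div, ENNReal.rpow_inv_le_iff hp,
    ENNReal.ofReal_rpow_of_nonneg (by positivity) hp.le]
  calc ∫⁻ x, ‖g x‖ₑ ^ p ∂P
      ≤ ENNReal.ofReal ((8 * a) ^ p) *
          ∫⁻ x, ENNReal.ofReal (Real.exp (p / 2 * √(‖g x‖ / a))) ∂P := by
        rw [← lintegral_const_mul' _ _ ENNReal.ofReal_ne_top]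
        exact lintegral_mono hpoint
    _ ≤ ENNReal.ofReal ((8 * a) ^ p) * ENNReal.ofReal (B ^ p) := by gcongr
    _ = ENNReal.ofReal ((8 * a * B) ^ p) := by
        rw [← ENNReal.ofReal_mul (by positivity), ← Real.mul_rpow (by positivity) hB]

variable [IsProbabilityMeasure P]

lemma lintegral_exp_mul_le_of_tail {W : α → ℝ} (hW : AEMeasurable W P) (hW₀ : ∀ x, 0 ≤ W x)
    {β C : ℝ} (hβ : 0 < β) (hC : 0 ≤ C)
    (htail : ∀ t, 0 < t → P {x | t < W x} ≤ ENNReal.ofReal (C * Real.exp (-(2 * β * t)))) :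
    ∫⁻ x, ENNReal.ofReal (Real.exp (β * W x)) ∂P ≤ ENNReal.ofReal (1 + C) := by
  have hexp (w : ℝ) : ∫ t in 0..w, β * Real.exp (β * t) = Real.exp (β * w) - 1 := by
    rw [intervalIntegral.integral_const_mul, ← smul_eq_mul,
      intervalIntegral.smul_integral_comp_mul_left]
    simp
  have hlayer : ∫⁻ x, ENNReal.ofReal (Real.exp (β * W x) - 1) ∂P ≤ ENNReal.ofReal C := by
    calc ∫⁻ x, ENNReal.ofReal (Real.exp (β * W x) - 1) ∂P
        = ∫⁻ t in Set.Ioi 0, P {x | t < W x} * ENNReal.ofReal (β * Real.exp (β * t)) := by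
          simp only [← hexp]
          exact lintegral_comp_eq_lintegral_meas_lt_mul P (.of_forall hW₀) hW
            (fun t _ => (by fun_prop : Continuous _).intervalIntegrable _ _)
            (.of_forall fun t => by positivity)
      _ ≤ ∫⁻ t in Set.Ioi 0, ENNReal.ofReal (C * β * Real.exp (-β * t)) := by
          refine setLIntegral_mono' measurableSet_Ioi fun t ht => ?_
          grw [htail t ht]
          rw [← ENNReal.ofReal_mul (by positivity), mul_mul_mul_comm, mul_assoc C, mul_assoc C,
            ← Real.exp_add]
          ring_nf
          rfl
      _ = ENNReal.ofReal C := by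
          rw [← ofReal_integral_eq_lintegral_ofReal
            ((integrableOn_exp_mul_Ioi (neg_lt_zero.2 hβ) 0).const_mul _)
            (.of_forall fun t => by positivity), integral_const_mul,
            integral_exp_mul_Ioi (neg_lt_zero.2 hβ)]
          simp [hβ.ne']
  calc ∫⁻ x, ENNReal.ofReal (Real.exp (β * W x)) ∂P
      = ∫⁻ x, (1 + ENNReal.ofReal (Real.exp (β * W x) - 1)) ∂P := by
        refine lintegral_congr fun x => ?_
        rw [← ENNReal.ofReal_one, ← ENNReal.ofReal_add zero_le_one
          (sub_nonneg.2 (Real.one_le_exp (mul_nonneg hβ.le (hW₀ x)))), add_sub_cancel]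
    _ = 1 + ∫⁻ x, ENNReal.ofReal (Real.exp (β * W x) - 1) ∂P := by
        rw [lintegral_add_left measurable_const, lintegral_one, measure_univ]
    _ ≤ ENNReal.ofReal (1 + C) := by
        rw [ENNReal.ofReal_add zero_le_one hC, ENNReal.ofReal_one]
        gcongr

theorem eLpNorm_le_of_tail (hg : AEStronglyMeasurable g P) (ha : 0 < a) (hp : 1 ≤ p) {C : ℝ}
    (hC : 0 ≤ C) (htail : ∀ w, 1 ≤ w →
      P {x | a * w ^ 2 < ‖g x‖} ≤ ENNReal.ofReal (C * Real.exp (-(p * w)))) :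
    eLpNorm g (ENNReal.ofReal p) P ≤ ENNReal.ofReal (8 * a * (Real.exp 1 * (2 + C))) := by
  have hp₀ : 0 < p := by linarith
  have hsqrt (w : ℝ) (hw : 0 < w) : P {x | w < √(‖g x‖ / a)} ≤
      ENNReal.ofReal ((1 + C) * Real.exp p * Real.exp (-(2 * (p / 2) * w))) := by
    rw [mul_div_cancel₀ p two_ne_zero, mul_assoc, ← Real.exp_add]
    rcases lt_or_ge w 1 with hw₁ | hw₁
    · refine prob_le_one.trans (ENNReal.one_le_ofReal.2 ?_)
      have hexp : 1 ≤ Real.exp (p + -(p * w)) := Real.one_le_exp (by nlinarith)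
      nlinarith
    · simp only [Real.lt_sqrt hw.le, lt_div_iff₀' ha]
      refine (htail w hw₁).trans (ENNReal.ofReal_le_ofReal ?_)
      gcongr <;> linarith
  have hconst : 1 + (1 + C) * Real.exp p ≤ (Real.exp 1 * (2 + C)) ^ p := by
    rw [Real.mul_rpow (by positivity) (by positivity), Real.exp_one_rpow]
    have hexp : 1 ≤ Real.exp p := Real.one_le_exp hp₀.le
    have hpow : 2 + C ≤ (2 + C) ^ p := Real.self_le_rpow_of_one_le (by linarith) hp
    nlinarith
  exact eLpNorm_le_of_lintegral_exp_sqrt_le ha hp₀ (by positivity) <|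
    (lintegral_exp_mul_le_of_tail (hg.norm.aemeasurable.div_const a).sqrt
      (fun x => Real.sqrt_nonneg _) (by positivity) (by positivity) hsqrt).trans
      (ENNReal.ofReal_le_ofReal hconst)

end Moments

section BlockNorm

variable {n q : ℕ} {f : (Fin 3 → ℕ) → (Fin 3 → ℝ) → ℝ}

theorem eLpNorm_rho_mul_blockSum_le (hf : ∀ r ∈ hyperbolicVectors n, IsBoundedRFunction r (f r))
    {J : Finset ℕ} (hq : 0 < q) (hqn : q ^ 3 ≤ n) (hJ : #J * q ≤ 2 * n) {p : ℝ} (hp : 1 ≤ p)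
    (hpn : p ≤ (n : ℝ) ^ (1 / 3 : ℝ)) :
    eLpNorm (fun x => rho n q * blockSum n J f x) (ENNReal.ofReal p) cubeMeasure ≤
      ENNReal.ofReal (160 * 8645 * Real.exp 1 * √p) := by
  convert eLpNorm_le_of_tail (a := 20 * √p) ((measurable_blockSum hf J).const_mul
    (rho n q)).aestronglyMeasurable (by positivity) hp (by norm_num : (0 : ℝ) ≤ 8643)
    (fun w hw => cubeMeasure_lt_abs_rho_mul_blockSum_le hf hq hqn hJ hp hpn hw) using 2
  ring

theorem cubeMeasure_lt_rho_mul_blockSum_le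
    (hf : ∀ r ∈ hyperbolicVectors n, IsBoundedRFunction r (f r)) {J : Finset ℕ} (hq : 0 < q)
    (hqn : q ^ 3 ≤ n) (hJ : #J * q ≤ 2 * n) {y : ℝ} (hy : 0 ≤ y)
    (hyn : y ≤ 20 * (n : ℝ) ^ (1 / 6 : ℝ)) :
    cubeMeasure {x | y < rho n q * blockSum n J f x} ≤
      ENNReal.ofReal (8643 * Real.exp (-(1 / 400) * y ^ 2)) := by
  rcases lt_or_ge y 20 with hy₂₀ | hy₂₀
  · refine prob_le_one.trans (ENNReal.one_le_ofReal.2 ?_)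
    have hexp : Real.exp (-1) ≤ Real.exp (-(1 / 400) * y ^ 2) := Real.exp_le_exp.2 (by nlinarith)
    linarith [Real.exp_neg_one_gt_d9]
  · have hp : 1 ≤ (y / 20) ^ 2 := one_le_pow₀ (by linarith)
    have hpn : (y / 20) ^ 2 ≤ (n : ℝ) ^ (1 / 3 : ℝ) :=
      calc (y / 20) ^ 2 ≤ ((n : ℝ) ^ (1 / 6 : ℝ)) ^ 2 := by gcongr; linarith
        _ = (n : ℝ) ^ (1 / 3 : ℝ) := by
          rw [← Real.rpow_natCast, ← Real.rpow_mul n.cast_nonneg]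
          norm_num
    have htail := cubeMeasure_lt_abs_rho_mul_blockSum_le hf hq hqn hJ hp hpn le_rfl
    rw [Real.sqrt_sq (by positivity), one_pow, mul_one, mul_div_cancel₀ y (by norm_num)] at htail
    calc cubeMeasure {x | y < rho n q * blockSum n J f x}
        ≤ cubeMeasure {x | y < |rho n q * blockSum n J f x|} :=
          measure_mono fun x (hx : y < _) => show y < |_| from hx.trans_le (le_abs_self _)
      _ ≤ ENNReal.ofReal (8643 * Real.exp (-(1 / 400) * y ^ 2)) := htail.trans_eq (by ring_nf)

end BlockNorm

lemma card_mul_le_of_isIntervalPartition {n q : ℕ} {I : Fin q → Finset ℕ}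
    (hI : IsIntervalPartition n q I) (hqn : q ^ 3 ≤ n) (t : Fin q) : #(I t) * q ≤ 2 * n := by
  have hcard : #(I t) ≤ n / q + 1 := by rcases hI.length t with h | h <;> omega
  have hq : q ≤ n := (Nat.le_self_pow three_ne_zero q).trans hqn
  calc #(I t) * q ≤ n / q * q + q := by rw [← Nat.succ_mul]; gcongr
    _ ≤ 2 * n := by linarith [Nat.div_mul_le_self n q]

end Hyperbolic

end

theorem mainTheorem4_general :
    ∃ c K : ℝ, 0 < c ∧ c < 1 ∧ 0 < K ∧
      ∀ n q : ℕ, 0 < q → q ^ 3 ≤ n →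
      ∀ J : Finset ℕ, J.card * q ≤ 2 * n →
      ∀ f : (Fin 3 → ℕ) → (Fin 3 → ℝ) → ℝ,
        (∀ r ∈ Hyperbolic.hyperbolicVectors n, Hyperbolic.IsBoundedRFunction r (f r)) →
        (∀ p : ℝ, 1 ≤ p → p ≤ c * (n : ℝ) ^ (1 / 3 : ℝ) →
          eLpNorm (fun x => Hyperbolic.rho n q * Hyperbolic.blockSum n J f x)
              (ENNReal.ofReal p) Hyperbolic.cubeMeasure
            ≤ ENNReal.ofReal (K * Real.sqrt p)) ∧
        (∀ y : ℝ, 0 ≤ y → y < c * (n : ℝ) ^ (1 / 6 : ℝ) →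
          Hyperbolic.cubeMeasure {x | y < Hyperbolic.rho n q * Hyperbolic.blockSum n J f x}
            ≤ ENNReal.ofReal (K * Real.exp (-c * y ^ 2))) := by
  refine ⟨1 / 400, 160 * 8645 * Real.exp 1, by norm_num, by norm_num, by positivity,
    fun n q hq hqn J hJ f hf => ⟨fun p hp hpn => ?_, fun y hy hyn => ?_⟩⟩
  · have : (0 : ℝ) ≤ (n : ℝ) ^ (1 / 3 : ℝ) := by positivity
    exact Hyperbolic.eLpNorm_rho_mul_blockSum_le hf hq hqn hJ hp (by linarith)
  · have : (0 : ℝ) ≤ (n : ℝ) ^ (1 / 6 : ℝ) := by positivity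
    refine (Hyperbolic.cubeMeasure_lt_rho_mul_blockSum_le hf hq hqn hJ hy (by linarith)).trans
      (ENNReal.ofReal_le_ofReal ?_)
    gcongr
    linarith [Real.add_one_le_exp 1]

theorem mainTheorem4 :
    ∃ c K : ℝ, 0 < c ∧ c < 1 ∧ 0 < K ∧
      ∀ (n q : ℕ), q ^ 3 ≤ n →
      ∀ (I : Fin q → Finset ℕ), Hyperbolic.IsIntervalPartition n q I →
      ∀ (f : (Fin 3 → ℕ) → (Fin 3 → ℝ) → ℝ),
        (∀ r ∈ Hyperbolic.hyperbolicVectors n, Hyperbolic.IsRFunction r (f r)) →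
      ∀ t : Fin q,
        (∀ p : ℝ, 1 ≤ p → p ≤ c * (n : ℝ) ^ (1 / 3 : ℝ) →
          MeasureTheory.eLpNorm
              (fun x => Hyperbolic.rho n q * Hyperbolic.blockSum n (I t) f x)
              (ENNReal.ofReal p) Hyperbolic.cubeMeasure
            ≤ ENNReal.ofReal (K * Real.sqrt p)) ∧
        (∀ y : ℝ, 0 ≤ y → y < c * (n : ℝ) ^ (1 / 6 : ℝ) →
          Hyperbolic.cubeMeasure
              {x | y < Hyperbolic.rho n q * Hyperbolic.blockSum n (I t) f x}
            ≤ ENNReal.ofReal (K * Real.exp (-c * y ^ 2))) := by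
  obtain ⟨c, K, hc, hc₁, hK, h⟩ := mainTheorem4_general
  exact ⟨c, K, hc, hc₁, hK, fun n q hqn I hI f hf t => h n q t.pos hqn (I t)
    (Hyperbolic.card_mul_le_of_isIntervalPartition hI hqn t) f
    fun r hr => Hyperbolic.isBoundedRFunction_of_isRFunction (hf r hr)⟩
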